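/- Let $\sigma>0$, let $g$ be the density of $N(0,\sigma^2)$, and let $\varphi:\mathbb R\to\mathbb R$ be measurable with $\int|\varphi(x)|\,g(x)\,dx<\infty$ and not equal Lebesgue-almost everywhere to a constant. For $\mu\in(0,1]$ and a probability density $f_0$ on $\mathbb R$ let $Y_1,\dots,Y_n$ be i.i.d. copies of $Y=\theta+\xi$, where $\theta$ and $\xi$ are independent, $\xi\sim N(0,\sigma^2)$, and $\theta$ has the sparse mixing distribution $\mu f_0(x)\,dx+(1-\mu)\delta_0(dx)$. Let $\mathbb E_{f_0}$ denote the expectation over $(Y_1,\dots,Y_n)$ and put $\Phi(f_0)=\int\varphi(\theta)f_0(\theta)\,d\theta$. For $C_I>0$ let $\mathcal P(C_I)$ be the set of all pairs $(f_1,f_2)$ of probability densities on $\mathbb R$ with $\int|\varphi|f_k<\infty$, $$I_k=\int g^{-1}(x)\Bigl[\int g(x-\theta)f_k(\theta)\,d\theta\Bigr]^2dx\le C_I\quad(k=1,2),\qquad \int\varphi(\theta)\,[f_1(\theta)-f_2(\theta)]\,d\theta\ne0 .$$ Then there are constants $C_I>0$ and $C>0$, depending only on $\sigma$ and $\varphi$,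 such that $\mathcal P(C_I)\neq\emptyset$ and, for every $n\ge1$ and every $\mu=\mu_n\in(0,1]$, $$\inf_{\widetilde\Phi}\ \sup_{(f_1,f_2)\in\mathcal P(C_I)}\ \max_{k=1,2}\ \mathbb E_{f_k}\bigl(\widetilde\Phi(Y_1,\dots,Y_n)-\Phi(f_k)\bigr)^2\ \ge\ C\min\bigl(1,(n\mu_n^2)^{-1}\bigr),$$ where the infimum is over all estimators, i.e. all measurable functions $\widetilde\Phi:\mathbb R^n\to\mathbb R$ (which may depend on $n$, $\mu_n$, $\sigma$, $\varphi$). -/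

import Mathlib

open MeasureTheory ProbabilityTheory Set
open scoped NNReal ENNReal

namespace SparseDeconv

noncomputable section

/-- `f` is a probability density function on the real line. -/
structure IsPDF (f : ℝ → ℝ) : Prop where
  measurable : Measurable f
  nonneg : ∀ x, 0 ≤ f x
  lintegral_eq_one : ∫⁻ x, ENNReal.ofReal (f x) = 1

/-- The law of the sparse mixing variable `θ`, with "density" `μ f₀ + (1 - μ) δ`. -/
def mixingLaw (μ : ℝ) (f₀ : ℝ → ℝ) : Measure ℝ :=
  ENNReal.ofReal μ • volume.withDensity (fun θ => ENNReal.ofReal (f₀ θ)) +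
    ENNReal.ofReal (1 - μ) • Measure.dirac 0

/-- The law of one observation `Y = θ + ξ`, where `θ` has the sparse mixing law and `ξ` is an
independent error with density `g`. -/
def observationLaw (g : ℝ → ℝ) (μ : ℝ) (f₀ : ℝ → ℝ) : Measure ℝ :=
  Measure.conv (mixingLaw μ f₀) (volume.withDensity (fun x => ENNReal.ofReal (g x)))

/-- The law of the sample `(Y₁, …, Yₙ)` of independent observations. -/
def sampleLaw (g : ℝ → ℝ) (n : ℕ) (μ : ℝ) (f₀ : ℝ → ℝ) : Measure (Fin n → ℝ) :=
  Measure.pi (fun _ => observationLaw g μ f₀)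

/-- The functional `Φ_μ = ∫ φ f₀` of the density `f₀` of the nonzero entries. -/
def functional (φ f₀ : ℝ → ℝ) : ℝ := ∫ θ, φ θ * f₀ θ

/-- The mean squared risk `E (T(Y₁, …, Yₙ) - Φ_μ)²` of the estimator `T` under `f₀`. -/
def risk (g φ : ℝ → ℝ) {n : ℕ} (μ : ℝ) (T : (Fin n → ℝ) → ℝ) (f₀ : ℝ → ℝ) : ℝ≥0∞ :=
  ∫⁻ y, ENNReal.ofReal ((T y - functional φ f₀) ^ 2) ∂(sampleLaw g n μ f₀)

/-- The integral `I = ∫ g⁻¹(x) [∫ g(x - θ) f(θ) dθ]² dx`. -/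
def chiIntegral (g f : ℝ → ℝ) : ℝ≥0∞ :=
  ∫⁻ x, (ENNReal.ofReal (g x))⁻¹ *
    (∫⁻ θ, ENNReal.ofReal (g (x - θ)) * ENNReal.ofReal (f θ)) ^ 2

/-- The pairs of densities `(f₁, f₂)`, with well-defined functionals, such that `I₁ ≤ C_I`,
`I₂ ≤ C_I` and `∫ φ (f₁ - f₂) ≠ 0`. -/
structure IsAdmissiblePair (g φ : ℝ → ℝ) (C_I : ℝ) (f₁ f₂ : ℝ → ℝ) : Prop where
  pdf₁ : IsPDF f₁
  pdf₂ : IsPDF f₂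
  integrable₁ : Integrable (fun θ => φ θ * f₁ θ)
  integrable₂ : Integrable (fun θ => φ θ * f₂ θ)
  chi₁ : chiIntegral g f₁ ≤ ENNReal.ofReal C_I
  chi₂ : chiIntegral g f₂ ≤ ENNReal.ofReal C_I
  separated : ∫ θ, φ θ * (f₁ θ - f₂ θ) ≠ 0

/-- The minimax risk: the infimum over all estimators `T` (measurable functions of the `n`
observations) of the supremum over all admissible pairs `(f₁, f₂)` of the larger of the two
risks of `T` under `f₁` and under `f₂`. -/
def minimaxRisk (g φ : ℝ → ℝ) (C_I : ℝ) (n : ℕ) (μ : ℝ) : ℝ≥0∞ :=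
  ⨅ (T : (Fin n → ℝ) → ℝ) (_ : Measurable T),
    ⨆ (f₁ : ℝ → ℝ) (f₂ : ℝ → ℝ) (_ : IsAdmissiblePair g φ C_I f₁ f₂),
      max (risk g φ μ T f₁) (risk g φ μ T f₂)

end

end SparseDeconv

namespace SparseDeconv

/-! ### The two-point lower bound -/

/-! The bound is Le Cam's two-point method along a segment of densities. Fix `f₁`, `f₂` with `D =
Φ(f₂) - Φ(f₁) ≠ 0` and compare `f₁` with `(1 - ε) f₁ + ε f₂`, where `ε² = min(1, 1/(nμ²))`. The
functionals differ by `εD`, while the observation densities differ by only `με (g*f₂ - g*f₁)`.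

If the density under `f₁` is at least `c g`, the χ² divergence of one observation is at most `(με)²
(I₁ + I₂)/c ≤ K₀/n` (`exists_likelihoodRatio`). The second moment of the likelihood ratio of the
whole sample then stays below `exp K₀` (`le_max_risk_pi`), so the risk is at least of order `ε²D²`.

The domination must be uniform in `μ`, including `μ = 1`, where the atom at `0` contributes nothing.
It therefore comes from `g*f₁` itself: `f₁` is uniform on `[-1, 1]`, and its symmetry gives `g*f₁ ≥
c g` (`le_convDensity_gaussian`). For `f₂`, the uniform density on some compact set works because
`φ` is not a.e. constant (`exists_isCompact_mean_ne`). Bounded supports bound the χ² integrals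
(`chiIntegral_gaussian_le`). -/

lemma sq_lintegral_mul_le {α : Type*} [MeasurableSpace α] (ν : Measure α) {u w : α → ℝ≥0∞}
    (hu : AEMeasurable u ν) (hw : AEMeasurable w ν) :
    (∫⁻ x, u x * w x ∂ν) ^ 2 ≤ (∫⁻ x, u x ^ 2 ∂ν) * ∫⁻ x, w x ^ 2 ∂ν := by
  have h := ENNReal.lintegral_mul_le_Lp_mul_Lq ν Real.HolderConjugate.two_two hu hw
  have h2 := pow_le_pow_left' h 2
  simp only [Pi.mul_apply, ENNReal.rpow_two, mul_pow] at h2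
  simpa only [← ENNReal.rpow_natCast, ← ENNReal.rpow_mul, Nat.cast_ofNat, one_div, ne_eq,
    OfNat.ofNat_ne_zero, not_false_eq_true, inv_mul_cancel₀, ENNReal.rpow_one] using h2

/-- Cauchy–Schwarz for `ℓ · 1_A`: an event rare under `P` remains rare under the tilted measure. -/
lemma sq_measure_le_of_withDensity {Ω : Type*} [MeasurableSpace Ω] {P : Measure Ω}
    {ℓ : Ω → ℝ≥0∞} (hℓ : Measurable ℓ) {A : Set Ω} (hA : MeasurableSet A) :
    (P.withDensity ℓ A) ^ 2 ≤ (∫⁻ x, ℓ x ^ 2 ∂P) * P A := by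
  have h := sq_lintegral_mul_le P hℓ.aemeasurable
    ((measurable_one.indicator hA : Measurable (A.indicator (1 : Ω → ℝ≥0∞))).aemeasurable)
  have e1 : ∀ x, ℓ x * A.indicator 1 x = A.indicator ℓ x := fun x => by
    by_cases hx : x ∈ A <;> simp [hx]
  have e2 : ∀ x, (A.indicator (1 : Ω → ℝ≥0∞) x) ^ 2 = A.indicator 1 x := fun x => by
    by_cases hx : x ∈ A <;> simp [hx]
  simp only [e1, e2, lintegral_indicator_one hA, lintegral_indicator hA] at h
  rwa [withDensity_apply _ hA]

lemma mul_measure_le_lintegral_sq {Ω : Type*} [MeasurableSpace Ω] (P : Measure Ω)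
    {T : Ω → ℝ} (hT : Measurable T) (a d : ℝ) {A : Set Ω}
    (hA : ∀ x ∈ A, d ^ 2 ≤ (T x - a) ^ 2) :
    ENNReal.ofReal (d ^ 2) * P A ≤ ∫⁻ x, ENNReal.ofReal ((T x - a) ^ 2) ∂P := by
  refine le_trans ?_ (mul_meas_ge_le_lintegral (μ := P) (by fun_prop) (ENNReal.ofReal (d ^ 2)))
  gcongr
  exact fun x hx => ENNReal.ofReal_le_ofReal (hA x hx)

/-- Le Cam's two-point lower bound, with the second moment of the likelihood ratio. -/
lemma le_max_risk_of_withDensity {Ω : Type*} [MeasurableSpace Ω] {P : Measure Ω}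
    {ℓ : Ω → ℝ≥0∞} (hℓ : Measurable ℓ) [IsProbabilityMeasure (P.withDensity ℓ)] {S : ℝ}
    (hS : 1 ≤ S) (hP : ∫⁻ x, ℓ x ^ 2 ∂P ≤ ENNReal.ofReal S)
    {T : Ω → ℝ} (hT : Measurable T) (a b : ℝ) :
    ENNReal.ofReal ((b - a) ^ 2 / (16 * S)) ≤
      max (∫⁻ x, ENNReal.ofReal ((T x - a) ^ 2) ∂P)
        (∫⁻ x, ENNReal.ofReal ((T x - b) ^ 2) ∂(P.withDensity ℓ)) := by
  set A : Set Ω := {x | ((b - a) / 2) ^ 2 ≤ (T x - a) ^ 2} with hAdef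
  have hA : MeasurableSet A := measurableSet_le (by fun_prop) (by fun_prop)
  have hS0 : 0 < S := by linarith
  have h1 := mul_measure_le_lintegral_sq P hT a ((b - a) / 2) (A := A) (fun x hx => hx)
  -- Off `A` the estimate is within `|b - a|/2` of `a`, hence at least that far from `b`.
  have h2 := mul_measure_le_lintegral_sq (P.withDensity ℓ) hT b ((b - a) / 2) (A := Aᶜ)
    (fun x hx => by
      have hx' : (T x - a) ^ 2 < ((b - a) / 2) ^ 2 := not_le.mp hx
      have h3 := sq_lt_sq.mp hx'
      apply sq_le_sq.mpr
      have h4 : |b - a| ≤ |T x - a| + |T x - b| := by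
        rw [abs_sub_comm (T x) b, add_comm]; exact abs_sub_le _ _ _
      rw [abs_div, abs_two] at *
      linarith)
  -- The threshold is chosen so that `P A < 1/(4S)` forces `Q(A)² ≤ S · 1/(4S) = 1/4` for the tilted
  -- measure `Q`, leaving `Aᶜ` with `Q`-mass at least `1/2`.
  by_cases hc : ENNReal.ofReal (1 / (4 * S)) ≤ P A
  · refine le_max_of_le_left (le_trans ?_ h1)
    refine le_trans (le_of_eq ?_) (mul_le_mul_right hc _)
    rw [← ENNReal.ofReal_mul (sq_nonneg _)]
    congr 1
    field_simp
    ring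
  · refine le_max_of_le_right (le_trans ?_ h2)
    have hQ : (P.withDensity ℓ A) ^ 2 ≤ (ENNReal.ofReal (1 / 2)) ^ 2 := by
      refine (sq_measure_le_of_withDensity hℓ hA).trans ((mul_le_mul' hP (not_le.mp hc).le).trans ?_)
      rw [← ENNReal.ofReal_mul hS0.le, ← ENNReal.ofReal_pow (by norm_num)]
      apply ENNReal.ofReal_le_ofReal
      apply le_of_eq
      field_simp
      norm_num
    have hQ' : P.withDensity ℓ A ≤ ENNReal.ofReal (1 / 2) :=
      (ENNReal.pow_right_strictMono (by norm_num)).le_iff_le.mp hQ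
    have hQc : ENNReal.ofReal (1 / 2) ≤ P.withDensity ℓ Aᶜ := by
      rw [prob_compl_eq_one_sub hA]
      refine le_trans ?_ (tsub_le_tsub_left hQ' 1)
      rw [← ENNReal.ofReal_one, ← ENNReal.ofReal_sub _ (by norm_num)]
      norm_num
    refine le_trans ?_ (mul_le_mul_right hQc _)
    rw [← ENNReal.ofReal_mul (sq_nonneg _)]
    apply ENNReal.ofReal_le_ofReal
    rw [div_le_iff₀ (by positivity)]
    nlinarith [sq_nonneg (b - a)]

lemma lintegral_pi_prod {ι α : Type*} [Fintype ι] [MeasurableSpace α] (P : Measure α)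
    [IsProbabilityMeasure P] {u : ι → α → ℝ≥0∞} (hu : ∀ i, Measurable (u i)) :
    ∫⁻ y, ∏ i, u i (y i) ∂(Measure.pi fun _ : ι => P) = ∏ i, ∫⁻ x, u i x ∂P := by
  have hind : iIndepFun (fun i (y : ι → α) => u i (y i)) (Measure.pi fun _ : ι => P) :=
    iIndepFun_pi (fun i => (hu i).aemeasurable)
  rw [lintegral_prod_eq_prod_lintegral_of_indepFun Finset.univ _ hind
    (fun i => (hu i).comp (measurable_pi_apply i))]
  refine Finset.prod_congr rfl fun i _ => ?_
  exact (measurePreserving_eval (fun _ : ι => P) i).lintegral_comp (hu i)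

lemma pi_withDensity {ι α : Type*} [Fintype ι] [MeasurableSpace α] (P : Measure α)
    [IsProbabilityMeasure P] {ℓ : α → ℝ≥0∞} (hℓ : Measurable ℓ)
    [IsProbabilityMeasure (P.withDensity ℓ)] :
    (Measure.pi fun _ : ι => P.withDensity ℓ) =
      (Measure.pi fun _ : ι => P).withDensity (fun y => ∏ i, ℓ (y i)) := by
  refine Measure.pi_eq fun s hs => ?_
  have hs' : MeasurableSet (univ.pi s) := MeasurableSet.univ_pi hs
  rw [withDensity_apply _ hs', ← lintegral_indicator hs']
  have e : ∀ y : ι → α, (univ.pi s).indicator (fun y => ∏ i, ℓ (y i)) y =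
      ∏ i, (s i).indicator ℓ (y i) := fun y => by
    by_cases hy : y ∈ univ.pi s
    · rw [indicator_of_mem hy]
      exact Finset.prod_congr rfl fun i _ => (indicator_of_mem (hy i (mem_univ i)) _).symm
    · rw [indicator_of_notMem hy]
      simp only [mem_pi, mem_univ, true_implies, not_forall] at hy
      obtain ⟨i, hi⟩ := hy
      exact (Finset.prod_eq_zero (Finset.mem_univ i) (indicator_of_notMem hi _)).symm
  simp_rw [e]
  rw [lintegral_pi_prod P fun i => hℓ.indicator (hs i)]
  refine Finset.prod_congr rfl fun i _ => ?_
  rw [lintegral_indicator (hs i), withDensity_apply _ (hs i)]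

/-- The two-point bound for samples of size `n` whose one-observation likelihood ratio has second
moment at most `exp (K / n)`. -/
lemma le_max_risk_pi {α : Type*} [MeasurableSpace α] {n : ℕ} (hn : 0 < n) {P Q : Measure α}
    [IsProbabilityMeasure P] [IsProbabilityMeasure Q] {ℓ : α → ℝ≥0∞} (hℓ : Measurable ℓ)
    (hQ : Q = P.withDensity ℓ) {K : ℝ} (hK : 0 ≤ K)
    (hP : ∫⁻ x, ℓ x ^ 2 ∂P ≤ ENNReal.ofReal (Real.exp (K / n)))
    {T : (Fin n → α) → ℝ} (hT : Measurable T) (a b : ℝ) :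
    ENNReal.ofReal ((b - a) ^ 2 / (16 * Real.exp K)) ≤
      max (∫⁻ y, ENNReal.ofReal ((T y - a) ^ 2) ∂(Measure.pi fun _ : Fin n => P))
        (∫⁻ y, ENNReal.ofReal ((T y - b) ^ 2) ∂(Measure.pi fun _ : Fin n => Q)) := by
  subst hQ
  have hpi := pi_withDensity (ι := Fin n) P hℓ
  have hprob : IsProbabilityMeasure
      ((Measure.pi fun _ : Fin n => P).withDensity (fun y => ∏ i, ℓ (y i))) := by
    rw [← hpi]; infer_instance
  rw [hpi]
  refine le_max_risk_of_withDensity (by fun_prop) (Real.one_le_exp hK) ?_ hT a b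
  simp_rw [← Finset.prod_pow]
  rw [lintegral_pi_prod P fun i => hℓ.pow_const 2]
  simp only [Finset.prod_const, Finset.card_univ, Fintype.card_fin]
  refine (pow_le_pow_left' hP n).trans (le_of_eq ?_)
  rw [← ENNReal.ofReal_pow (Real.exp_pos _).le, ← Real.exp_nat_mul]
  congr 2
  have : (n : ℝ) ≠ 0 := by positivity
  field_simp

/-! ### The density of one observation -/

/-- The convolution of the error density `g` with the density `f`. -/
noncomputable def convDensity (g f : ℝ → ℝ) (x : ℝ) : ℝ≥0∞ :=
  ∫⁻ θ, ENNReal.ofReal (g (x - θ)) * ENNReal.ofReal (f θ)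

lemma measurable_convDensity {g f : ℝ → ℝ} (hg : Measurable g) (hf : Measurable f) :
    Measurable (convDensity g f) := by
  have : Measurable (Function.uncurry fun x θ : ℝ =>
      ENNReal.ofReal (g (x - θ)) * ENNReal.ofReal (f θ)) := by
    unfold Function.uncurry; fun_prop
  exact this.lintegral_prod_right

/-- The density of one observation. -/
noncomputable def observationDensity (g : ℝ → ℝ) (μ : ℝ) (f : ℝ → ℝ) (x : ℝ) : ℝ≥0∞ :=
  ENNReal.ofReal μ * convDensity g f x + ENNReal.ofReal (1 - μ) * ENNReal.ofReal (g x)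

lemma measurable_observationDensity {g f : ℝ → ℝ} (hg : Measurable g) (hf : Measurable f)
    (μ : ℝ) : Measurable (observationDensity g μ f) := by
  have := measurable_convDensity hg hf
  unfold observationDensity
  fun_prop

lemma IsPDF.isProbabilityMeasure {f : ℝ → ℝ} (hf : IsPDF f) :
    IsProbabilityMeasure (volume.withDensity fun θ => ENNReal.ofReal (f θ)) :=
  ⟨by rw [withDensity_apply _ MeasurableSet.univ, setLIntegral_univ, hf.lintegral_eq_one]⟩

lemma isPDF_gaussianPDFReal {v : ℝ≥0} (hv : v ≠ 0) : IsPDF (gaussianPDFReal 0 v) :=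
  ⟨measurable_gaussianPDFReal _ _, gaussianPDFReal_nonneg _ _,
    lintegral_gaussianPDFReal_eq_one 0 hv⟩

lemma observationLaw_eq_withDensity {g f : ℝ → ℝ} (hg : IsPDF g) (hf : IsPDF f) (μ : ℝ) :
    observationLaw g μ f = volume.withDensity (observationDensity g μ f) := by
  have := hg.isProbabilityMeasure
  have := hf.isProbabilityMeasure
  have hgm := hg.measurable
  have hfm := hf.measurable
  unfold observationLaw mixingLaw
  rw [Measure.add_conv, Measure.conv_smul_left, Measure.conv_smul_left, Measure.dirac_zero_conv,
    conv_withDensity_eq_lconvolution (by fun_prop) (by fun_prop)]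
  have e : (fun θ => ENNReal.ofReal (f θ)) ⋆ₗ[volume] (fun x => ENNReal.ofReal (g x)) =
      convDensity g f := by
    funext x
    rw [lconvolution_def, convDensity]
    refine lintegral_congr fun θ => ?_
    rw [mul_comm, sub_eq_neg_add]
  have hm := measurable_convDensity hgm hfm
  rw [e, ← withDensity_smul _ hm, ← withDensity_smul _ (by fun_prop),
    ← withDensity_add_left (hm.const_smul _)]
  rfl

lemma isProbabilityMeasure_observationLaw {g f : ℝ → ℝ} (hg : IsPDF g) (hf : IsPDF f) {μ : ℝ}
    (h0 : 0 ≤ μ) (h1 : μ ≤ 1) : IsProbabilityMeasure (observationLaw g μ f) := by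
  have := hg.isProbabilityMeasure
  have := hf.isProbabilityMeasure
  have : IsProbabilityMeasure (mixingLaw μ f) := ⟨by
    simp only [mixingLaw, Measure.coe_add, Measure.coe_smul, Pi.add_apply, Pi.smul_apply,
      measure_univ, smul_eq_mul, mul_one]
    rw [← ENNReal.ofReal_add h0 (by linarith)]
    simp⟩
  unfold observationLaw
  infer_instance

lemma lintegral_observationDensity {g f : ℝ → ℝ} (hg : IsPDF g) (hf : IsPDF f) {μ : ℝ}
    (h0 : 0 ≤ μ) (h1 : μ ≤ 1) : ∫⁻ x, observationDensity g μ f x = 1 := by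
  have := isProbabilityMeasure_observationLaw hg hf h0 h1
  have h := measure_univ (μ := observationLaw g μ f)
  rwa [observationLaw_eq_withDensity hg hf, withDensity_apply _ MeasurableSet.univ,
    setLIntegral_univ] at h

/-- The mixture `(1 - ε) f₁ + ε f₂`. -/
def mixture (ε : ℝ) (f₁ f₂ : ℝ → ℝ) (θ : ℝ) : ℝ := (1 - ε) * f₁ θ + ε * f₂ θ

lemma IsPDF.mixture {f₁ f₂ : ℝ → ℝ} (h₁ : IsPDF f₁) (h₂ : IsPDF f₂) {ε : ℝ} (h0 : 0 ≤ ε)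
    (h1 : ε ≤ 1) : IsPDF (mixture ε f₁ f₂) := by
  have m₁ := h₁.measurable
  have m₂ := h₂.measurable
  have h1' : 0 ≤ 1 - ε := by linarith
  refine ⟨by unfold SparseDeconv.mixture; fun_prop, fun x => ?_, ?_⟩
  · exact add_nonneg (mul_nonneg h1' (h₁.nonneg x)) (mul_nonneg h0 (h₂.nonneg x))
  · have e : ∀ x, ENNReal.ofReal (SparseDeconv.mixture ε f₁ f₂ x) = ENNReal.ofReal (1 - ε) *
        ENNReal.ofReal (f₁ x) + ENNReal.ofReal ε * ENNReal.ofReal (f₂ x) := fun x => by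
      rw [SparseDeconv.mixture, ENNReal.ofReal_add (mul_nonneg h1' (h₁.nonneg x))
        (mul_nonneg h0 (h₂.nonneg x)), ENNReal.ofReal_mul h1', ENNReal.ofReal_mul h0]
    simp_rw [e]
    rw [lintegral_add_left (by fun_prop), lintegral_const_mul _ (by fun_prop),
      lintegral_const_mul _ (by fun_prop), h₁.lintegral_eq_one, h₂.lintegral_eq_one, mul_one,
      mul_one, ← ENNReal.ofReal_add h1' h0]
    simp

lemma convDensity_mixture {g f₁ f₂ : ℝ → ℝ} (hg : Measurable g) (h₁ : IsPDF f₁) (h₂ : IsPDF f₂)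
    {ε : ℝ} (h0 : 0 ≤ ε) (h1 : ε ≤ 1) (x : ℝ) :
    convDensity g (mixture ε f₁ f₂) x =
      ENNReal.ofReal (1 - ε) * convDensity g f₁ x + ENNReal.ofReal ε * convDensity g f₂ x := by
  have m₁ := h₁.measurable
  have m₂ := h₂.measurable
  have h1' : 0 ≤ 1 - ε := by linarith
  unfold convDensity
  rw [← lintegral_const_mul _ (by fun_prop), ← lintegral_const_mul _ (by fun_prop),
    ← lintegral_add_left (by fun_prop)]
  refine lintegral_congr fun θ => ?_
  rw [mixture, ENNReal.ofReal_add (mul_nonneg h1' (h₁.nonneg θ))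
    (mul_nonneg h0 (h₂.nonneg θ)), ENNReal.ofReal_mul h1', ENNReal.ofReal_mul h0]
  ring

/-! ### The second moment of the likelihood ratio -/

/-- With `p`, `q` the two observation densities, `q²/p + p - 2q = (q - p)²/p` and `q - p = mε(b -
a)`. Since `a` and `g` are both at least `c g`, so is `p`. The terms are arranged so that nothing is
subtracted, which suits integration in `ℝ≥0∞`. -/
lemma sq_div_add_le {a b g c m ε : ℝ} (ha : 0 ≤ a) (hb : 0 ≤ b) (hg : 0 < g) (hc : 0 < c)
    (hc1 : c ≤ 1) (hag : c * g ≤ a) (hm0 : 0 ≤ m) (hm1 : m ≤ 1) :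
    (m * ((1 - ε) * a + ε * b) + (1 - m) * g) ^ 2 / (m * a + (1 - m) * g) +
        (m * a + (1 - m) * g) ≤
      2 * (m * ((1 - ε) * a + ε * b) + (1 - m) * g) +
        (m * ε) ^ 2 / c * (g⁻¹ * a ^ 2 + g⁻¹ * b ^ 2) := by
  have hcg : 0 < c * g := mul_pos hc hg
  have hp : c * g ≤ m * a + (1 - m) * g := by
    nlinarith [mul_le_mul_of_nonneg_left hag hm0,
      mul_nonneg (mul_nonneg (sub_nonneg.2 hm1) (sub_nonneg.2 hc1)) hg.le]
  have hp0 : 0 < m * a + (1 - m) * g := hcg.trans_le hp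
  have key : (m * ε) ^ 2 * (b - a) ^ 2 / (m * a + (1 - m) * g) ≤
      (m * ε) ^ 2 * (a ^ 2 + b ^ 2) / (c * g) := by
    gcongr
    nlinarith [mul_nonneg ha hb]
  have e1 : (m * ((1 - ε) * a + ε * b) + (1 - m) * g) ^ 2 / (m * a + (1 - m) * g) +
        (m * a + (1 - m) * g) - 2 * (m * ((1 - ε) * a + ε * b) + (1 - m) * g) =
      (m * ε) ^ 2 * (b - a) ^ 2 / (m * a + (1 - m) * g) := by
    rw [eq_div_iff hp0.ne', sub_mul, add_mul, div_mul_cancel₀ _ hp0.ne']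
    ring
  have e2 : (m * ε) ^ 2 / c * (g⁻¹ * a ^ 2 + g⁻¹ * b ^ 2) =
      (m * ε) ^ 2 * (a ^ 2 + b ^ 2) / (c * g) := by
    field_simp
  linarith

lemma convDensity_ne_top {g f : ℝ → ℝ} (hf : IsPDF f) {B : ℝ} (hB : ∀ x, g x ≤ B) (x : ℝ) :
    convDensity g f x ≠ ∞ := by
  have hfm := hf.measurable
  refine ne_top_of_le_ne_top (b := ENNReal.ofReal B) ENNReal.ofReal_ne_top ?_
  calc convDensity g f x ≤ ∫⁻ θ, ENNReal.ofReal B * ENNReal.ofReal (f θ) :=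
        lintegral_mono fun θ => by gcongr; exact hB _
    _ = ENNReal.ofReal B := by
        rw [lintegral_const_mul _ (by fun_prop), hf.lintegral_eq_one, mul_one]

/-- If the observation density under `f₁` dominates a multiple of `g`, then the likelihood ratio of
the mixture `(1 - ε) f₁ + ε f₂` against `f₁` has second moment `1 + O(μ² ε²)`. -/
lemma exists_likelihoodRatio {g f₁ f₂ : ℝ → ℝ} (hg : IsPDF g) (hgpos : ∀ x, 0 < g x) {B : ℝ}
    (hB : ∀ x, g x ≤ B) (h₁ : IsPDF f₁) (h₂ : IsPDF f₂) {C c : ℝ} (hC : 0 ≤ C)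
    (hI₁ : chiIntegral g f₁ ≤ ENNReal.ofReal C) (hI₂ : chiIntegral g f₂ ≤ ENNReal.ofReal C)
    (hc : 0 < c) (hc1 : c ≤ 1)
    (hlow : ∀ x, ENNReal.ofReal c * ENNReal.ofReal (g x) ≤ convDensity g f₁ x)
    {μ ε : ℝ} (hμ0 : 0 < μ) (hμ1 : μ ≤ 1) (hε0 : 0 ≤ ε) (hε1 : ε ≤ 1) :
    ∃ ℓ : ℝ → ℝ≥0∞, Measurable ℓ ∧
      observationLaw g μ (mixture ε f₁ f₂) = (observationLaw g μ f₁).withDensity ℓ ∧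
      ∫⁻ x, ℓ x ^ 2 ∂(observationLaw g μ f₁) ≤
        ENNReal.ofReal (1 + 2 * C / c * (μ * ε) ^ 2) := by
  have hgm := hg.measurable
  have hfe := h₁.mixture h₂ hε0 hε1
  set f := mixture ε f₁ f₂ with hf
  have hmp := measurable_observationDensity hgm h₁.measurable μ
  have hmq := measurable_observationDensity hgm hfe.measurable μ
  have hp_top : ∀ x, observationDensity g μ f₁ x ≠ ∞ := fun x => by
    have := convDensity_ne_top h₁ hB x
    unfold observationDensity; finiteness
  have hp_zero : ∀ x, observationDensity g μ f₁ x ≠ 0 := fun x => by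
    have h3 : 0 < convDensity g f₁ x := by
      refine lt_of_lt_of_le ?_ (hlow x)
      exact ENNReal.mul_pos (ENNReal.ofReal_pos.2 hc).ne' (ENNReal.ofReal_pos.2 (hgpos x)).ne'
    have h4 := ENNReal.mul_pos (ENNReal.ofReal_pos.2 hμ0).ne' h3.ne'
    exact (h4.trans_le le_self_add).ne'
  set ℓ : ℝ → ℝ≥0∞ := fun x => observationDensity g μ f x / observationDensity g μ f₁ x with hℓ
  have hmℓ : Measurable ℓ := hmq.div hmp
  refine ⟨ℓ, hmℓ, ?_, ?_⟩
  · rw [observationLaw_eq_withDensity hg hfe, observationLaw_eq_withDensity hg h₁,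
      ← withDensity_mul _ hmp hmℓ]
    congr 1
    funext x
    exact (ENNReal.mul_div_cancel (hp_zero x) (hp_top x)).symm
  rw [observationLaw_eq_withDensity hg h₁, lintegral_withDensity_eq_lintegral_mul _ hmp
    (hmℓ.pow_const 2)]
  have hpt : ∀ x, (observationDensity g μ f₁ * fun x => ℓ x ^ 2) x + observationDensity g μ f₁ x ≤
      2 * observationDensity g μ f x + ENNReal.ofReal ((μ * ε) ^ 2 / c) *
        ((ENNReal.ofReal (g x))⁻¹ * convDensity g f₁ x ^ 2 +
          (ENNReal.ofReal (g x))⁻¹ * convDensity g f₂ x ^ 2) := fun x => by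
    obtain ⟨a, ha, hax⟩ : ∃ a : ℝ, 0 ≤ a ∧ convDensity g f₁ x = ENNReal.ofReal a :=
      ⟨_, ENNReal.toReal_nonneg, (ENNReal.ofReal_toReal (convDensity_ne_top h₁ hB x)).symm⟩
    obtain ⟨b, hb, hbx⟩ : ∃ b : ℝ, 0 ≤ b ∧ convDensity g f₂ x = ENNReal.ofReal b :=
      ⟨_, ENNReal.toReal_nonneg, (ENNReal.ofReal_toReal (convDensity_ne_top h₂ hB x)).symm⟩
    have hgx := hgpos x
    have hag : c * g x ≤ a := by
      have := hlow x
      rwa [hax, ← ENNReal.ofReal_mul hc.le, ENNReal.ofReal_le_ofReal_iff ha] at this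
    have hμ1' : 0 ≤ 1 - μ := by linarith
    have hε1' : 0 ≤ 1 - ε := by linarith
    have hP : observationDensity g μ f₁ x = ENNReal.ofReal (μ * a + (1 - μ) * g x) := by
      rw [observationDensity, hax, ENNReal.ofReal_add (by positivity) (by positivity),
        ENNReal.ofReal_mul hμ0.le, ENNReal.ofReal_mul hμ1']
    have hQ : observationDensity g μ f x =
        ENNReal.ofReal (μ * ((1 - ε) * a + ε * b) + (1 - μ) * g x) := by
      rw [observationDensity, hf, convDensity_mixture hgm h₁ h₂ hε0 hε1, hax, hbx,
        ENNReal.ofReal_add (by positivity) (by positivity),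
        ENNReal.ofReal_mul hμ0.le, ENNReal.ofReal_mul hμ1',
        ENNReal.ofReal_add (by positivity) (by positivity),
        ENNReal.ofReal_mul hε0, ENNReal.ofReal_mul hε1']
    have hppos : 0 < μ * a + (1 - μ) * g x := by
      have := hp_zero x
      rw [hP] at this
      exact ENNReal.ofReal_pos.1 (pos_iff_ne_zero.2 this)
    have key := sq_div_add_le (ε := ε) ha hb hgx hc hc1 hag hμ0.le hμ1
    simp only [Pi.mul_apply, hℓ]
    rw [hP, hQ, hax, hbx, ← ENNReal.ofReal_div_of_pos hppos, ← ENNReal.ofReal_inv_of_pos hgx,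
      ← ENNReal.ofReal_pow (by positivity), ← ENNReal.ofReal_pow ha, ← ENNReal.ofReal_pow hb,
      ← ENNReal.ofReal_mul hppos.le, ← ENNReal.ofReal_add (by positivity) hppos.le,
      ← ENNReal.ofReal_mul (by positivity), ← ENNReal.ofReal_mul (by positivity),
      ← ENNReal.ofReal_add (by positivity) (by positivity),
      ← ENNReal.ofReal_mul (by positivity), ← ENNReal.ofReal_ofNat,
      ← ENNReal.ofReal_mul (by positivity),
      ← ENNReal.ofReal_add (by positivity) (by positivity)]
    apply ENNReal.ofReal_le_ofReal
    refine le_trans (le_of_eq ?_) key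
    congr 1
    field_simp
  have hmc₁ := measurable_convDensity hgm h₁.measurable
  have hmc₂ := measurable_convDensity hgm h₂.measurable
  have hint := lintegral_mono (μ := volume) hpt
  rw [lintegral_add_right _ hmp, lintegral_observationDensity hg h₁ hμ0.le hμ1,
    lintegral_add_left (by fun_prop), lintegral_const_mul _ hmq,
    lintegral_observationDensity hg hfe hμ0.le hμ1, lintegral_const_mul _ (by fun_prop),
    lintegral_add_left (by fun_prop)] at hint
  have hI : ENNReal.ofReal ((μ * ε) ^ 2 / c) *
      ((∫⁻ x, (ENNReal.ofReal (g x))⁻¹ * convDensity g f₁ x ^ 2) +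
        ∫⁻ x, (ENNReal.ofReal (g x))⁻¹ * convDensity g f₂ x ^ 2) ≤
      ENNReal.ofReal (2 * C / c * (μ * ε) ^ 2) := by
    calc _ ≤ ENNReal.ofReal ((μ * ε) ^ 2 / c) * (ENNReal.ofReal C + ENNReal.ofReal C) := by
          gcongr
          · exact hI₁
          · exact hI₂
      _ = _ := by
          rw [← ENNReal.ofReal_add hC hC, ← ENNReal.ofReal_mul (by positivity)]
          congr 1
          ring
  have h5 := hint.trans (add_le_add_right hI _)
  -- One of the two unit masses on the right cancels the mass of `p` on the left.
  rw [mul_one, show (2 : ℝ≥0∞) = 1 + 1 from one_add_one_eq_two.symm, add_right_comm] at h5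
  rw [ENNReal.ofReal_add zero_le_one (by positivity), ENNReal.ofReal_one]
  exact (ENNReal.add_le_add_iff_right ENNReal.one_ne_top).1 h5

/-! ### Gaussian errors and densities with bounded support -/

lemma gaussianPDFReal_zero_le (v : ℝ≥0) (x : ℝ) :
    gaussianPDFReal 0 v x ≤ (√(2 * Real.pi * v))⁻¹ := by
  rw [gaussianPDFReal]
  refine mul_le_of_le_one_right (by positivity) (Real.exp_le_one_iff.2 ?_)
  exact div_nonpos_of_nonpos_of_nonneg (neg_nonpos.2 (sq_nonneg _)) (by positivity)

/-- Completing the square in `x`; the right side integrates over `x` to `exp (θ²/v)`. -/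
lemma inv_mul_gaussianPDFReal_sub_sq {v : ℝ≥0} (hv : v ≠ 0) (x θ : ℝ) :
    (gaussianPDFReal 0 v x)⁻¹ * gaussianPDFReal 0 v (x - θ) ^ 2 =
      Real.exp (θ ^ 2 / v) * gaussianPDFReal 0 v (x - 2 * θ) := by
  have hv' : (v : ℝ) ≠ 0 := by exact_mod_cast hv
  rw [inv_mul_eq_iff_eq_mul₀ (gaussianPDFReal_pos _ _ _ hv).ne']
  simp only [gaussianPDFReal, sub_zero]
  rw [mul_pow, ← Real.exp_nat_mul]
  have : Real.exp ((2 : ℕ) * (-(x - θ) ^ 2 / (2 * v))) = Real.exp (-x ^ 2 / (2 * v)) *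
      (Real.exp (θ ^ 2 / v) * Real.exp (-(x - 2 * θ) ^ 2 / (2 * v))) := by
    rw [← Real.exp_add, ← Real.exp_add]
    congr 1
    field_simp
    push_cast
    ring
  rw [this]
  ring

lemma sq_convDensity_le {g f : ℝ → ℝ} (hg : Measurable g) (hf : IsPDF f) (x : ℝ) :
    convDensity g f x ^ 2 ≤ ∫⁻ θ, ENNReal.ofReal (g (x - θ)) ^ 2 * ENNReal.ofReal (f θ) := by
  have hfm := hf.measurable
  have := hf.isProbabilityMeasure
  have h := sq_lintegral_mul_le (volume.withDensity fun θ => ENNReal.ofReal (f θ))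
    (u := fun θ => ENNReal.ofReal (g (x - θ))) (w := 1) (by fun_prop) (by fun_prop)
  simp only [Pi.one_apply, mul_one, one_pow, lintegral_one, measure_univ] at h
  rw [lintegral_withDensity_eq_lintegral_mul _ (by fun_prop) (by fun_prop),
    lintegral_withDensity_eq_lintegral_mul _ (by fun_prop) (by fun_prop)] at h
  simpa only [Pi.mul_apply, mul_comm (ENNReal.ofReal (f _)), convDensity] using h

/-- Jensen moves the square inside the average over `f`; Tonelli and the completed square then leave
the `f`-average of `exp (θ²/v)`. -/
lemma chiIntegral_gaussian_le {v : ℝ≥0} (hv : v ≠ 0) {f : ℝ → ℝ} (hf : IsPDF f) {M : ℝ}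
    (hM : ∀ θ, M < |θ| → f θ = 0) :
    chiIntegral (gaussianPDFReal 0 v) f ≤ ENNReal.ofReal (Real.exp (M ^ 2 / v)) := by
  have hfm := hf.measurable
  have hgm := measurable_gaussianPDFReal 0 v
  have hgpos := fun x => gaussianPDFReal_pos 0 v x hv
  calc chiIntegral (gaussianPDFReal 0 v) f
      ≤ ∫⁻ x, ∫⁻ θ, ENNReal.ofReal (Real.exp (θ ^ 2 / v)) *
          ENNReal.ofReal (gaussianPDFReal 0 v (x - 2 * θ)) * ENNReal.ofReal (f θ) := by
        refine lintegral_mono fun x => ?_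
        refine (mul_le_mul_right (sq_convDensity_le hgm hf x) _).trans (le_of_eq ?_)
        rw [← lintegral_const_mul _ (by fun_prop)]
        refine lintegral_congr fun θ => ?_
        rw [← ENNReal.ofReal_inv_of_pos (hgpos x), ← mul_assoc,
          ← ENNReal.ofReal_pow (hgpos _).le, ← ENNReal.ofReal_mul (inv_nonneg.2 (hgpos x).le),
          inv_mul_gaussianPDFReal_sub_sq hv, ENNReal.ofReal_mul (Real.exp_pos _).le]
    _ = ∫⁻ θ, ∫⁻ x, ENNReal.ofReal (Real.exp (θ ^ 2 / v)) *
          ENNReal.ofReal (gaussianPDFReal 0 v (x - 2 * θ)) * ENNReal.ofReal (f θ) := by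
        refine lintegral_lintegral_swap (Measurable.aemeasurable ?_)
        unfold Function.uncurry; fun_prop
    _ = ∫⁻ θ, ENNReal.ofReal (Real.exp (θ ^ 2 / v)) * ENNReal.ofReal (f θ) := by
        refine lintegral_congr fun θ => ?_
        rw [lintegral_mul_const _ (by fun_prop), lintegral_const_mul _ (by fun_prop),
          lintegral_sub_right_eq_self (fun x => ENNReal.ofReal (gaussianPDFReal 0 v x)),
          lintegral_gaussianPDFReal_eq_one 0 hv, mul_one]
    _ ≤ ∫⁻ θ, ENNReal.ofReal (Real.exp (M ^ 2 / v)) * ENNReal.ofReal (f θ) := by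
        refine lintegral_mono fun θ => ?_
        by_cases h : M < |θ|
        · simp [hM θ h]
        · have : θ ^ 2 ≤ M ^ 2 := by
            rw [← sq_abs θ]; exact pow_le_pow_left₀ (abs_nonneg _) (not_lt.1 h) 2
          gcongr
    _ = _ := by rw [lintegral_const_mul _ (by fun_prop), hf.lintegral_eq_one, mul_one]

/-- The sum on the right is `2 g(x) exp(-θ²/(2v)) cosh(xθ/v)`, and `cosh ≥ 1`. -/
lemma two_mul_gaussianPDFReal_le {v : ℝ≥0} {x θ : ℝ} (hθ : |θ| ≤ 1) :
    2 * (Real.exp (-(1 / (2 * v))) * gaussianPDFReal 0 v x) ≤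
      gaussianPDFReal 0 v (x - θ) + gaussianPDFReal 0 v (x + θ) := by
  set e : ℝ := Real.exp (-(1 / (2 * v))) with he
  set k : ℝ := (√(2 * Real.pi * v))⁻¹ with hk
  set G := Real.exp (-x ^ 2 / (2 * v)) with hG
  set t : ℝ := x * θ / v with ht
  have hθ2 : θ ^ 2 ≤ 1 := by rw [← sq_abs]; exact pow_le_one₀ (abs_nonneg _) hθ
  have h1 : ∀ s : ℝ, s ^ 2 = θ ^ 2 → e * G * Real.exp (x * s / v) ≤
      Real.exp (-(x - s) ^ 2 / (2 * v)) := fun s hs => by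
    rw [he, hG, ← Real.exp_add, ← Real.exp_add]
    apply Real.exp_le_exp.2
    have h3 : -(x - s) ^ 2 / (2 * (v : ℝ)) =
        -(s ^ 2 / (2 * v)) + -x ^ 2 / (2 * v) + x * s / v := by
      rcases eq_or_ne (v : ℝ) 0 with h | h
      · simp [h]
      · field_simp; ring
    rw [h3, hs]
    gcongr
  have h4 : 2 ≤ Real.exp t + Real.exp (-t) := by
    have := Real.one_le_cosh t
    rw [Real.cosh_eq] at this
    linarith
  have h5 := h1 θ rfl
  have h6 := h1 (-θ) (by ring)
  rw [mul_neg, neg_div, sub_neg_eq_add] at h6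
  simp only [gaussianPDFReal, sub_zero, ← hk, ← hG]
  have hk0 : 0 ≤ k := by positivity
  have heG : 0 ≤ e * G := by positivity
  calc 2 * (e * (k * G)) = k * (e * G * 2) := by ring
    _ ≤ k * (e * G * (Real.exp t + Real.exp (-t))) := by gcongr
    _ ≤ k * (Real.exp (-(x - θ) ^ 2 / (2 * v)) + Real.exp (-(x + θ) ^ 2 / (2 * v))) := by
        gcongr; rw [mul_add]; exact add_le_add h5 h6
    _ = _ := by ring

/-- Symmetry allows averaging over `θ` and `-θ`. A one-sided shift of `g` would not dominate a
multiple of `g` in the opposite tail. -/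
lemma le_convDensity_gaussian {v : ℝ≥0} {f : ℝ → ℝ} (hf : IsPDF f)
    (hsymm : ∀ θ, f (-θ) = f θ) (hM : ∀ θ, 1 < |θ| → f θ = 0) (x : ℝ) :
    ENNReal.ofReal (Real.exp (-(1 / (2 * v)))) * ENNReal.ofReal (gaussianPDFReal 0 v x) ≤
      convDensity (gaussianPDFReal 0 v) f x := by
  have hfm := hf.measurable
  have hgm := measurable_gaussianPDFReal 0 v
  have hg0 := gaussianPDFReal_nonneg 0 v
  have hrefl : convDensity (gaussianPDFReal 0 v) f x =
      ∫⁻ θ, ENNReal.ofReal (gaussianPDFReal 0 v (x + θ)) * ENNReal.ofReal (f θ) := by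
    rw [convDensity, ← lintegral_sub_left_eq_self _ (0 : ℝ)]
    simp only [zero_sub, sub_neg_eq_add, hsymm]
  refine (ENNReal.mul_le_mul_iff_right (a := 2) (by norm_num) (by norm_num)).1 ?_
  calc 2 * (ENNReal.ofReal (Real.exp (-(1 / (2 * v)))) * ENNReal.ofReal (gaussianPDFReal 0 v x))
      = ∫⁻ θ, ENNReal.ofReal (2 * (Real.exp (-(1 / (2 * v))) * gaussianPDFReal 0 v x)) *
          ENNReal.ofReal (f θ) := by
        rw [lintegral_const_mul _ (by fun_prop), hf.lintegral_eq_one, mul_one,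
          ENNReal.ofReal_mul (by norm_num), ENNReal.ofReal_mul (Real.exp_pos _).le,
          ENNReal.ofReal_ofNat]
    _ ≤ ∫⁻ θ, (ENNReal.ofReal (gaussianPDFReal 0 v (x - θ)) * ENNReal.ofReal (f θ) +
          ENNReal.ofReal (gaussianPDFReal 0 v (x + θ)) * ENNReal.ofReal (f θ)) := by
        refine lintegral_mono fun θ => ?_
        by_cases h : 1 < |θ|
        · simp [hM θ h]
        · rw [← add_mul, ← ENNReal.ofReal_add (hg0 _) (hg0 _)]
          gcongr
          exact two_mul_gaussianPDFReal_le (not_lt.1 h)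
    _ = 2 * convDensity (gaussianPDFReal 0 v) f x := by
        rw [lintegral_add_left (by fun_prop), ← hrefl, two_mul]
        rfl

/-! ### Uniform densities -/

/-- The uniform density on `K`. -/
noncomputable def uniformDensity (K : Set ℝ) : ℝ → ℝ := K.indicator fun _ => (volume.real K)⁻¹

lemma isPDF_uniformDensity {K : Set ℝ} (hK : IsCompact K) (h0 : volume.real K ≠ 0) :
    IsPDF (uniformDensity K) := by
  have hm := hK.measurableSet
  have hpos : 0 < volume.real K := lt_of_le_of_ne measureReal_nonneg h0.symm
  refine ⟨measurable_const.indicator hm,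
    fun x => indicator_nonneg (fun _ _ => inv_nonneg.2 measureReal_nonneg) x, ?_⟩
  have e : ∀ x, ENNReal.ofReal (uniformDensity K x) =
      K.indicator (fun _ => ENNReal.ofReal (volume.real K)⁻¹) x := fun x => by
    by_cases hx : x ∈ K <;> simp [uniformDensity, hx]
  simp_rw [e]
  rw [lintegral_indicator hm, setLIntegral_const, ENNReal.ofReal_inv_of_pos hpos,
    ofReal_measureReal hK.measure_ne_top]
  refine ENNReal.inv_mul_cancel (fun h => h0 ?_) hK.measure_ne_top
  simp [Measure.real, h]

lemma mul_uniformDensity (φ : ℝ → ℝ) (K : Set ℝ) :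
    (fun θ => φ θ * uniformDensity K θ) = K.indicator fun θ => φ θ * (volume.real K)⁻¹ := by
  funext θ
  by_cases hx : θ ∈ K <;> simp [uniformDensity, hx]

lemma integrable_mul_uniformDensity {φ : ℝ → ℝ} (hφ : LocallyIntegrable φ) {K : Set ℝ}
    (hK : IsCompact K) : Integrable fun θ => φ θ * uniformDensity K θ := by
  rw [mul_uniformDensity, integrable_indicator_iff hK.measurableSet]
  exact (hφ.integrableOn_isCompact hK).mul_const _

lemma functional_uniformDensity (φ : ℝ → ℝ) {K : Set ℝ} (hK : IsCompact K) :
    functional φ (uniformDensity K) = (∫ θ in K, φ θ) * (volume.real K)⁻¹ := by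
  rw [functional, mul_uniformDensity, integral_indicator hK.measurableSet, integral_mul_const]

/-- `1/g` is continuous, hence bounded on compact sets. -/
lemma locallyIntegrable_of_integrable_mul {φ g : ℝ → ℝ} (hg : Continuous g) (hg0 : ∀ x, g x ≠ 0)
    (h : Integrable fun x => φ x * g x) : LocallyIntegrable φ := by
  rw [locallyIntegrable_iff]
  intro K hK
  have := h.integrableOn (s := K) |>.mul_continuousOn (hg.inv₀ hg0).continuousOn hK
  simpa [mul_assoc, hg0] using this

/-- A locally integrable function that is not almost everywhere constant has, for every `c`, a mean
different from `c` over some compact set of positive measure. -/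
lemma exists_isCompact_mean_ne {φ : ℝ → ℝ} (hφ : LocallyIntegrable φ)
    (hne : ¬ ∃ c : ℝ, ∀ᵐ x : ℝ, φ x = c) (c : ℝ) :
    ∃ K : Set ℝ, IsCompact K ∧ volume.real K ≠ 0 ∧ functional φ (uniformDensity K) ≠ c := by
  by_contra! hall
  refine hne ⟨c, ?_⟩
  have hloc : LocallyIntegrable fun x => φ x - c := hφ.sub (locallyIntegrable_const c)
  -- If every mean equals `c`, then `φ - c` integrates to zero over every compact set, trivially
  -- over null ones.
  have := ae_eq_zero_of_forall_setIntegral_isCompact_eq_zero' hloc fun K hK => by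
    rw [integral_sub (hφ.integrableOn_isCompact hK)
      (integrableOn_const hK.measure_ne_top), setIntegral_const, smul_eq_mul]
    by_cases h0 : volume.real K = 0
    · have h0' : volume K = 0 := (measureReal_eq_zero_iff hK.measure_ne_top).1 h0
      rw [setIntegral_measure_zero _ h0', h0]
      simp
    · have h := hall K hK h0
      rw [functional_uniformDensity φ hK] at h
      rw [← h]
      field_simp
      simp
  filter_upwards [this] with x hx
  exact sub_eq_zero.1 hx

end SparseDeconv

/-! ### Choice of the two densities and of the constants -/

open SparseDeconv

theorem corollary3 (σ : ℝ≥0) (hσ : σ ≠ 0) (φ : ℝ → ℝ)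
    (hφ : Integrable (fun x => φ x * gaussianPDFReal 0 (σ ^ 2) x))
    (hφ_nonconst : ¬ ∃ c : ℝ, ∀ᵐ x : ℝ, φ x = c) :
    ∃ C_I : ℝ, 0 < C_I ∧
      (∃ f₁ f₂ : ℝ → ℝ,
        SparseDeconv.IsAdmissiblePair (gaussianPDFReal 0 (σ ^ 2)) φ C_I f₁ f₂) ∧
      ∃ C : ℝ, 0 < C ∧ ∀ n : ℕ, 0 < n → ∀ μ : ℝ, 0 < μ → μ ≤ 1 →
        ENNReal.ofReal (C * min 1 ((n : ℝ) * μ ^ 2)⁻¹) ≤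
          SparseDeconv.minimaxRisk (gaussianPDFReal 0 (σ ^ 2)) φ C_I n μ := by
  have hv : σ ^ 2 ≠ 0 := pow_ne_zero _ hσ
  generalize σ ^ 2 = v at *
  set g := gaussianPDFReal 0 v with hgdef
  have hg : IsPDF g := isPDF_gaussianPDFReal hv
  have hgpos : ∀ x, 0 < g x := fun x => gaussianPDFReal_pos 0 v x hv
  have hgcont : Continuous g := by
    rw [hgdef, gaussianPDFReal_def]; fun_prop
  have hloc := locallyIntegrable_of_integrable_mul hgcont (fun x => (hgpos x).ne') hφ
  set f₁ := uniformDensity (Icc (-1) 1) with hf₁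
  have hpdf₁ : IsPDF f₁ := isPDF_uniformDensity isCompact_Icc (by
    rw [Real.volume_real_Icc]; norm_num)
  obtain ⟨K, hK, hK0, hKne⟩ := exists_isCompact_mean_ne hloc hφ_nonconst (functional φ f₁)
  set f₂ := uniformDensity K with hf₂
  have hpdf₂ : IsPDF f₂ := isPDF_uniformDensity hK hK0
  have hint₁ : Integrable fun θ => φ θ * f₁ θ := integrable_mul_uniformDensity hloc isCompact_Icc
  have hint₂ : Integrable fun θ => φ θ * f₂ θ := integrable_mul_uniformDensity hloc hK
  obtain ⟨R, hR⟩ := hK.isBounded.exists_norm_le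
  set M := max 1 R
  have hsupp₁' : ∀ θ, 1 < |θ| → f₁ θ = 0 := fun θ hθ =>
    indicator_of_notMem (fun h : θ ∈ Icc (-1 : ℝ) 1 => absurd (abs_le.2 h) (not_le.2 hθ)) _
  have hsupp₁ : ∀ θ, M < |θ| → f₁ θ = 0 := fun θ hθ =>
    hsupp₁' θ ((le_max_left _ _).trans_lt hθ)
  have hsupp₂ : ∀ θ, M < |θ| → f₂ θ = 0 := fun θ hθ =>
    indicator_of_notMem
      (fun h => absurd ((hR θ h).trans (le_max_right 1 R)) (not_le.2 hθ)) _
  have hsymm : ∀ θ, f₁ (-θ) = f₁ θ := fun θ => by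
    have : -θ ∈ Icc (-1 : ℝ) 1 ↔ θ ∈ Icc (-1 : ℝ) 1 := by
      rw [mem_Icc, mem_Icc, ← abs_le, ← abs_le, abs_neg]
    rw [hf₁, uniformDensity]
    by_cases h : θ ∈ Icc (-1 : ℝ) 1
    · rw [indicator_of_mem h, indicator_of_mem (this.2 h)]
    · rw [indicator_of_notMem h, indicator_of_notMem (mt this.1 h)]
  set D := functional φ f₂ - functional φ f₁ with hD
  have hD0 : D ≠ 0 := sub_ne_zero.2 hKne
  -- All mixtures of `f₁` and `f₂` vanish outside `[-M, M]`, so one constant serves every `ε`.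
  set CI := Real.exp (M ^ 2 / v) with hCI
  have hCI0 : 0 < CI := Real.exp_pos _
  have hfun : ∀ ε, functional φ (mixture ε f₁ f₂) = functional φ f₁ + ε * D := fun ε => by
    have e : ∀ θ, φ θ * mixture ε f₁ f₂ θ = (1 - ε) * (φ θ * f₁ θ) + ε * (φ θ * f₂ θ) :=
      fun θ => by rw [mixture]; ring
    simp only [functional, hD, e]
    rw [integral_add (hint₁.const_mul _) (hint₂.const_mul _), integral_const_mul,
      integral_const_mul]
    ring
  have hadm : ∀ ε, 0 < ε → ε ≤ 1 → IsAdmissiblePair g φ CI f₁ (mixture ε f₁ f₂) := by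
    intro ε h0 h1
    have hpdf := hpdf₁.mixture hpdf₂ h0.le h1
    have hint : Integrable fun θ => φ θ * mixture ε f₁ f₂ θ := by
      refine ((hint₁.const_mul (1 - ε)).add (hint₂.const_mul ε)).congr
        (Filter.Eventually.of_forall fun θ => ?_)
      simp only [mixture, Pi.add_apply]
      ring
    refine ⟨hpdf₁, hpdf, hint₁, hint, chiIntegral_gaussian_le hv hpdf₁ hsupp₁,
      chiIntegral_gaussian_le hv hpdf fun θ hθ => ?_, ?_⟩
    · simp [mixture, hsupp₁ θ hθ, hsupp₂ θ hθ]
    · have e : ∫ θ, φ θ * (f₁ θ - mixture ε f₁ f₂ θ) = -(ε * D) := by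
        simp_rw [mul_sub]
        rw [integral_sub hint₁ hint]
        have := hfun ε
        unfold functional at this
        rw [this]
        ring
      rw [e]
      exact neg_ne_zero.2 (mul_ne_zero h0.ne' hD0)
  refine ⟨CI, hCI0, ⟨f₁, _, hadm 1 one_pos le_rfl⟩, ?_⟩
  set c := Real.exp (-(1 / (2 * (v : ℝ)))) with hc
  have hc0 : 0 < c := Real.exp_pos _
  have hc1 : c ≤ 1 := Real.exp_le_one_iff.2 (neg_nonpos.2 (by positivity))
  set K₀ := 2 * CI / c with hK₀
  have hK₀0 : 0 < K₀ := by positivity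
  refine ⟨D ^ 2 / (16 * Real.exp K₀), by positivity, fun n hn μ hμ0 hμ1 => ?_⟩
  have hn' : (0 : ℝ) < n := by exact_mod_cast hn
  -- The mixing weight is `ε = √r`: it is at most `1`, satisfies `(με)² ≤ 1/n`, and makes the
  -- squared separation `r D²`.
  set r := min 1 ((n : ℝ) * μ ^ 2)⁻¹ with hr
  have hr0 : 0 < r := lt_min one_pos (by positivity)
  have hε1 : √r ≤ 1 := Real.sqrt_le_one.2 (min_le_left _ _)
  have hε0 : 0 < √r := Real.sqrt_pos.2 hr0
  have hA := hadm _ hε0 hε1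
  obtain ⟨ℓ, hℓ, hQ, hP⟩ := exists_likelihoodRatio hg hgpos (gaussianPDFReal_zero_le v) hpdf₁
    hpdf₂ hCI0.le (chiIntegral_gaussian_le hv hpdf₁ hsupp₁)
    (chiIntegral_gaussian_le hv hpdf₂ hsupp₂) hc0 hc1
    (le_convDensity_gaussian hpdf₁ hsymm hsupp₁') hμ0 hμ1 hε0.le hε1
  have := isProbabilityMeasure_observationLaw hg hpdf₁ hμ0.le hμ1
  have := isProbabilityMeasure_observationLaw hg hA.pdf₂ hμ0.le hμ1
  have hP' : ∫⁻ x, ℓ x ^ 2 ∂(observationLaw g μ f₁) ≤ ENNReal.ofReal (Real.exp (K₀ / n)) := by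
    refine hP.trans (ENNReal.ofReal_le_ofReal ?_)
    have h1 : (μ * √r) ^ 2 ≤ 1 / (n : ℝ) := by
      rw [mul_pow, Real.sq_sqrt hr0.le]
      calc μ ^ 2 * r ≤ μ ^ 2 * ((n : ℝ) * μ ^ 2)⁻¹ := by gcongr; exact min_le_right _ _
        _ = 1 / (n : ℝ) := by field_simp
    calc 1 + K₀ * (μ * √r) ^ 2 ≤ 1 + K₀ * (1 / n) := by gcongr
      _ = K₀ / n + 1 := by ring
      _ ≤ _ := Real.add_one_le_exp _
  refine le_iInf₂ fun T hT => ?_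
  refine le_trans ?_ (le_iSup_of_le f₁ (le_iSup_of_le (mixture √r f₁ f₂)
    (le_iSup_of_le hA le_rfl)))
  refine le_trans (le_of_eq ?_) (le_max_risk_pi hn hℓ hQ hK₀0.le hP' hT _ _)
  rw [hfun, add_sub_cancel_left, mul_pow, Real.sq_sqrt hr0.le]
  congr 1
  ring
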